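/- \textbf{Theorem.} A \emph{$B$-term} is a term built by application from the single combinator $B = \lambda x.\lambda y.\lambda z.\, x\,(y\,z)$. Two $B$-terms are \emph{equivalent} if the $\lambda$-terms that they denote are $\beta\eta$-equivalent. For $B$-terms $e_1, e_2$ write $e_1 \circ e_2$ for the $B$-term $B\,e_1\,e_2$ (this operation is associative up to equivalence; take compositions bracketed to the left), and for an integer $n \ge 0$ let $B^n B = B(B(\cdots(B\,B)\cdots))$ be the $B$-term obtained by applying $B$ to $B$ in this way $n$ times, so that $B^0B = B$ and $B^{n+1}B = B\,(B^nB)$. Then for every $B$-term $e$ there is exactly one finite non-empty sequence of integers $n_1 \ge n_2 \ge \dots \ge n_k \ge 0$ (with $k \ge 1$) such that $e$ is equivalent to \[ (B^{n_1} B) \circ (B^{n_2} B) \circ \dots \circ (B^{n_k} B). \] -/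

import Mathlib

namespace BCL

/-- Untyped λ-terms in de Bruijn notation, that is, λ-terms up to α-renaming. -/
inductive LambdaTerm : Type
  | var : ℕ → LambdaTerm
  | app : LambdaTerm → LambdaTerm → LambdaTerm
  | lam : LambdaTerm → LambdaTerm
  deriving DecidableEq

namespace LambdaTerm

/-- The extension of a renaming of variables under one binder. -/
def liftRen (r : ℕ → ℕ) : ℕ → ℕ
  | 0 => 0
  | n + 1 => r n + 1

/-- Simultaneous renaming of the free variables. -/
def rename : (ℕ → ℕ) → LambdaTerm → LambdaTerm
  | r, var n => var (r n)
  | r, app M N => app (rename r M) (rename r N)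
  | r, lam M => lam (rename (liftRen r) M)

/-- The extension of a substitution under one binder. -/
def liftSub (s : ℕ → LambdaTerm) : ℕ → LambdaTerm
  | 0 => var 0
  | n + 1 => rename Nat.succ (s n)

/-- Simultaneous capture-avoiding substitution for the free variables. -/
def subst : (ℕ → LambdaTerm) → LambdaTerm → LambdaTerm
  | s, var n => s n
  | s, app M N => app (subst s M) (subst s N)
  | s, lam M => lam (subst (liftSub s) M)

/-- The substitution that replaces variable `0` by `N` and lowers the other variables by one. -/
def single (N : LambdaTerm) : ℕ → LambdaTerm
  | 0 => N
  | n + 1 => var n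

/-- One-step βη-reduction: the closure under all term constructors of
`(λx. M) N → M[N/x]` and of `λx. M x → M` for `x` not free in `M`. -/
inductive BetaEtaStep : LambdaTerm → LambdaTerm → Prop
  | beta (M N : LambdaTerm) : BetaEtaStep (app (lam M) N) (subst (single N) M)
  | eta (M : LambdaTerm) : BetaEtaStep (lam (app (rename Nat.succ M) (var 0))) M
  | appLeft {M M' : LambdaTerm} (N : LambdaTerm) :
      BetaEtaStep M M' → BetaEtaStep (app M N) (app M' N)
  | appRight (M : LambdaTerm) {N N' : LambdaTerm} :
      BetaEtaStep N N' → BetaEtaStep (app M N) (app M N')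
  | lam {M M' : LambdaTerm} : BetaEtaStep M M' → BetaEtaStep (lam M) (lam M')

/-- βη-equivalence: the least equivalence relation that contains one-step βη-reduction. -/
def BetaEtaEq : LambdaTerm → LambdaTerm → Prop :=
  Relation.EqvGen BetaEtaStep

end LambdaTerm

/-- `B`-terms: the combinatory terms built from `B` alone by application. -/
inductive BTerm : Type
  | B : BTerm
  | app : BTerm → BTerm → BTerm
  deriving DecidableEq

namespace BTerm

/-- The λ-term denoted by a `B`-term, where `B = λx. λy. λz. x (y z)`. -/
def toLambda : BTerm → LambdaTerm
  | B => .lam (.lam (.lam (.app (.var 2) (.app (.var 1) (.var 0)))))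
  | app e₁ e₂ => .app (toLambda e₁) (toLambda e₂)

/-- βη-equivalence of `B`-terms: βη-equivalence of the λ-terms that they denote. -/
def Equivalent (e₁ e₂ : BTerm) : Prop :=
  LambdaTerm.BetaEtaEq e₁.toLambda e₂.toLambda

/-- The composition `e₁ ∘ e₂`, which is the `B`-term `B e₁ e₂`. -/
def comp (e₁ e₂ : BTerm) : BTerm :=
  app (app B e₁) e₂

/-- The monomial `Bⁿ B = B (B (⋯ (B B)⋯))`, with `B` applied `n` times to `B`. -/
def monomial : ℕ → BTerm
  | 0 => B
  | n + 1 => app B (monomial n)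

/-- The polynomial `(B^{n₁} B) ∘ (B^{n₂} B) ∘ ⋯ ∘ (B^{nₖ} B)` with the non-empty list of degrees
`[n₁, n₂, …, nₖ]`; the compositions are bracketed to the left. -/
def polynomial (ns : List ℕ) (hns : ns ≠ []) : BTerm :=
  ns.tail.foldl (fun P n => comp P (monomial n)) (monomial (ns.head hns))

end BTerm

end BCL

/-!
A `B`-term is determined up to βη-equivalence by how it regroups a sequence of arguments.

*Existence.* The classes of λ-terms modulo βη-equivalence form an applicative structure in which
`B x y z = x (y z)`, composition is associative, `B (x ∘ y) = B x ∘ B y` and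
`B ∘ B x = B (B x) ∘ B`; the last three laws follow from the first one by extensionality, that is,
by η (`comp_assoc`, `b_comp`, `comp_b_b`). The last two give
`(Bᵐ B) ∘ (Bⁿ B) = (Bⁿ⁺¹ B) ∘ (Bᵐ B)` for `m < n` (`comp_monomial_of_lt`), the relations of
Thompson's monoid, with which every composition of monomials can be sorted. The sorted polynomials
are closed under application (`IsSortedPolynomial.app`): to apply a composition is to apply its
monomials in turn, `B (P₁ ∘ ⋯ ∘ Pₖ) = B P₁ ∘ ⋯ ∘ B Pₖ`, and `(Bⁿ⁺¹ B) P = (Bⁿ B) ∘ P`.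

*Uniqueness.* The monomial `Bⁿ B` sends `f x₀ x₁ …` to `f x₀ … xₙ₋₁ (xₙ xₙ₊₁) xₙ₊₂ …`
(`clsApps_monomial`), so a polynomial applied to sufficiently many variables is equivalent to an
abstraction-free term that records the successive merges of arguments. Abstraction-free terms are
normal, so by the Church–Rosser theorem equivalent ones are equal
(`IsApplicative.eq_of_betaEtaEq`). From the resulting sequence of arguments the sorted list of
degrees is read off from its last entry backwards: the last degree is the first position that does
not hold a variable, and this last merge can be undone (`eq_of_act_eq`).

Church–Rosser for βη is proved by Takahashi's method: a single parallel reduction for β and η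
together, in which all reducts of a term have a common reduct, its complete development
(`Par.exists_development`).
-/

namespace BCL

namespace LambdaTerm

/-! ### Renaming and substitution -/

theorem liftRen_comp (r s : ℕ → ℕ) (n : ℕ) :
    liftRen r (liftRen s n) = liftRen (fun k => r (s k)) n := by
  cases n <;> rfl

theorem rename_rename (M : LambdaTerm) :
    ∀ r s : ℕ → ℕ, rename r (rename s M) = rename (fun n => r (s n)) M := by
  induction M with
  | var n => intro r s; rfl
  | app M N ihM ihN => intro r s; simp only [rename, ihM, ihN]
  | lam M ih => intro r s; simp only [rename, ih, liftRen_comp]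

theorem subst_rename (M : LambdaTerm) :
    ∀ (s : ℕ → LambdaTerm) (r : ℕ → ℕ), subst s (rename r M) = subst (fun n => s (r n)) M := by
  induction M with
  | var n => intro s r; rfl
  | app M N ihM ihN => intro s r; simp only [rename, subst, ihM, ihN]
  | lam M ih =>
    intro s r
    simp only [rename, subst, ih]
    congr 2
    funext n
    cases n <;> rfl

theorem rename_subst (M : LambdaTerm) :
    ∀ (r : ℕ → ℕ) (s : ℕ → LambdaTerm), rename r (subst s M) = subst (fun n => rename r (s n)) M := by
  induction M with
  | var n => intro r s; rfl
  | app M N ihM ihN => intro r s; simp only [rename, subst, ihM, ihN]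
  | lam M ih =>
    intro r s
    simp only [rename, subst, ih]
    congr 2
    funext n
    cases n with
    | zero => rfl
    | succ n => simp only [liftSub, rename_rename, liftRen]

theorem subst_subst (M : LambdaTerm) :
    ∀ s t : ℕ → LambdaTerm, subst s (subst t M) = subst (fun n => subst s (t n)) M := by
  induction M with
  | var n => intro s t; rfl
  | app M N ihM ihN => intro s t; simp only [subst, ihM, ihN]
  | lam M ih =>
    intro s t
    simp only [subst, ih]
    congr 2
    funext n
    cases n with
    | zero => rfl
    | succ n => simp only [liftSub, subst_rename, rename_subst]

theorem subst_var (M : LambdaTerm) : subst var M = M := by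
  induction M with
  | var n => rfl
  | app M N ihM ihN => simp only [subst, ihM, ihN]
  | lam M ih =>
    have h : liftSub var = var := by
      funext n
      cases n <;> rfl
    simp only [subst, h, ih]

theorem subst_single_rename_succ (M N : LambdaTerm) : subst (single N) (rename Nat.succ M) = M := by
  rw [subst_rename]
  exact subst_var M

theorem rename_succ_injective : Function.Injective (rename Nat.succ) := fun M N h => by
  rw [← subst_single_rename_succ M (var 0), h, subst_single_rename_succ]

theorem rename_liftRen_succ (r : ℕ → ℕ) (M : LambdaTerm) :
    rename (liftRen r) (rename Nat.succ M) = rename Nat.succ (rename r M) := by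
  simp only [rename_rename, liftRen]

theorem subst_liftSub_succ (s : ℕ → LambdaTerm) (M : LambdaTerm) :
    subst (liftSub s) (rename Nat.succ M) = rename Nat.succ (subst s M) := by
  simp only [subst_rename, rename_subst, liftSub]

theorem rename_subst_single (r : ℕ → ℕ) (M N : LambdaTerm) :
    rename r (subst (single N) M) = subst (single (rename r N)) (rename (liftRen r) M) := by
  rw [rename_subst, subst_rename]
  congr 1
  funext n
  cases n <;> rfl

theorem subst_subst_single (s : ℕ → LambdaTerm) (M N : LambdaTerm) :
    subst s (subst (single N) M) = subst (single (subst s N)) (subst (liftSub s) M) := by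
  rw [subst_subst, subst_subst]
  congr 1
  funext n
  cases n with
  | zero => rfl
  | succ n => simp only [single, subst, liftSub, subst_single_rename_succ]

theorem subst_single_var_rename (M : LambdaTerm) :
    subst (single (var 0)) (rename (liftRen Nat.succ) M) = M := by
  rw [subst_rename]
  refine Eq.trans ?_ (subst_var M)
  congr 1
  funext n
  cases n <;> rfl

/-- Renaming turns a pullback square of maps of variables into a pullback square of maps of
terms: two terms with a common renaming both come from a third term. -/
theorem exists_of_rename_eq_rename (L : LambdaTerm) :
    ∀ (M : LambdaTerm) (r s p q : ℕ → ℕ),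
      (∀ n m, r n = s m → ∃ k, n = q k ∧ m = p k) → rename r L = rename s M →
        ∃ K, L = rename q K ∧ M = rename p K := by
  induction L with
  | var n =>
    intro M r s p q h e
    cases M with
    | var m =>
      obtain ⟨k, rfl, rfl⟩ := h n m (by simpa [rename] using e)
      exact ⟨var k, rfl, rfl⟩
    | app => simp [rename] at e
    | lam => simp [rename] at e
  | app L₁ L₂ ih₁ ih₂ =>
    intro M r s p q h e
    cases M with
    | var => simp [rename] at e
    | app M₁ M₂ =>
      simp only [rename, app.injEq] at e
      obtain ⟨K₁, rfl, rfl⟩ := ih₁ M₁ r s p q h e.1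
      obtain ⟨K₂, rfl, rfl⟩ := ih₂ M₂ r s p q h e.2
      exact ⟨app K₁ K₂, rfl, rfl⟩
    | lam => simp [rename] at e
  | lam L ih =>
    intro M r s p q h e
    cases M with
    | var => simp [rename] at e
    | app => simp [rename] at e
    | lam M =>
      simp only [rename, lam.injEq] at e
      obtain ⟨K, rfl, rfl⟩ := ih M (liftRen r) (liftRen s) (liftRen p) (liftRen q) (by
        intro n m hnm
        cases n with
        | zero =>
          cases m with
          | zero => exact ⟨0, rfl, rfl⟩
          | succ m => simp [liftRen] at hnm
        | succ n =>
          cases m with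
          | zero => simp [liftRen] at hnm
          | succ m =>
            obtain ⟨k, rfl, rfl⟩ := h n m (by simpa [liftRen] using hnm)
            exact ⟨k + 1, rfl, rfl⟩) e
      exact ⟨lam K, rfl, rfl⟩

/-- The number of constructors of a term. -/
def size : LambdaTerm → ℕ
  | var _ => 1
  | app M N => size M + size N + 1
  | lam M => size M + 1

theorem size_rename (M : LambdaTerm) : ∀ r : ℕ → ℕ, size (rename r M) = size M := by
  induction M with
  | var n => intro r; rfl
  | app M N ihM ihN => intro r; simp only [rename, size, ihM, ihN]
  | lam M ih => intro r; simp only [rename, size, ih]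

/-! ### Parallel βη-reduction -/

/-- Parallel βη-reduction: any set of β- and η-redexes already present in the term is contracted
simultaneously. In `eta` the body is given by an equation, which keeps the indices of the family
in constructor form. -/
inductive Par : LambdaTerm → LambdaTerm → Prop
  | var (n : ℕ) : Par (var n) (var n)
  | app {M M' N N' : LambdaTerm} : Par M M' → Par N N' → Par (app M N) (app M' N')
  | lam {M M' : LambdaTerm} : Par M M' → Par (lam M) (lam M')
  | beta {M M' N N' : LambdaTerm} :
      Par M M' → Par N N' → Par (app (lam M) N) (subst (single N') M')
  | eta {X M M' : LambdaTerm} :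
      X = rename Nat.succ M → Par M M' → Par (lam (app X (LambdaTerm.var 0))) M'

theorem Par.refl (M : LambdaTerm) : Par M M := by
  induction M with
  | var n => exact .var n
  | app M N ihM ihN => exact .app ihM ihN
  | lam M ih => exact .lam ih

theorem Par.of_step {M N : LambdaTerm} (h : BetaEtaStep M N) : Par M N := by
  induction h with
  | beta M N => exact .beta (.refl M) (.refl N)
  | eta M => exact .eta rfl (.refl M)
  | appLeft N _ ih => exact .app ih (.refl N)
  | appRight M _ ih => exact .app (.refl M) ih
  | lam _ ih => exact .lam ih

theorem Par.rename {M N : LambdaTerm} (h : Par M N) :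
    ∀ r : ℕ → ℕ, Par (rename r M) (rename r N) := by
  induction h with
  | var n => intro r; exact .var _
  | app _ _ ihM ihN => intro r; exact .app (ihM r) (ihN r)
  | lam _ ih => intro r; exact .lam (ih _)
  | beta _ _ ihM ihN =>
    intro r
    rw [rename_subst_single]
    exact .beta (ihM _) (ihN r)
  | eta hX _ ih =>
    intro r
    refine .eta ?_ (ih r)
    rw [hX, rename_liftRen_succ]

theorem Par.liftSub {s t : ℕ → LambdaTerm} (h : ∀ n, Par (s n) (t n)) (n : ℕ) :
    Par (liftSub s n) (liftSub t n) := by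
  cases n with
  | zero => exact .var 0
  | succ n => exact (h n).rename _

theorem Par.subst {M N : LambdaTerm} (h : Par M N) :
    ∀ {s t : ℕ → LambdaTerm}, (∀ n, Par (s n) (t n)) → Par (subst s M) (subst t N) := by
  induction h with
  | var n => intro s t hst; exact hst n
  | app _ _ ihM ihN => intro s t hst; exact .app (ihM hst) (ihN hst)
  | lam _ ih => intro s t hst; exact .lam (ih (Par.liftSub hst))
  | beta _ _ ihM ihN =>
    intro s t hst
    rw [subst_subst_single]
    exact .beta (ihM (Par.liftSub hst)) (ihN hst)
  | eta hX _ ih =>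
    intro s t hst
    refine .eta ?_ (ih hst)
    rw [hX, subst_liftSub_succ]

theorem Par.subst_single {M M' N N' : LambdaTerm} (hM : Par M M') (hN : Par N N') :
    Par (LambdaTerm.subst (single N) M) (LambdaTerm.subst (single N') M') :=
  hM.subst fun n => by
    cases n with
    | zero => exact hN
    | succ n => exact .var n

/-- A parallel reduct of a renamed term is a renamed parallel reduct. -/
theorem Par.of_rename {M N : LambdaTerm} (h : Par M N) :
    ∀ {r : ℕ → ℕ} {L : LambdaTerm}, M = LambdaTerm.rename r L →
      ∃ L', N = LambdaTerm.rename r L' ∧ Par L L' := by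
  induction h with
  | var n => intro r L e; exact ⟨L, e, .refl L⟩
  | app _ _ ihM ihN =>
    intro r L e
    cases L with
    | app L₁ L₂ =>
      simp only [LambdaTerm.rename, LambdaTerm.app.injEq] at e
      obtain ⟨L₁', rfl, h₁⟩ := ihM e.1
      obtain ⟨L₂', rfl, h₂⟩ := ihN e.2
      exact ⟨LambdaTerm.app L₁' L₂', rfl, .app h₁ h₂⟩
    | var => simp [LambdaTerm.rename] at e
    | lam => simp [LambdaTerm.rename] at e
  | lam _ ih =>
    intro r L e
    cases L with
    | lam L =>
      simp only [LambdaTerm.rename, LambdaTerm.lam.injEq] at e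
      obtain ⟨L', rfl, h⟩ := ih e
      exact ⟨LambdaTerm.lam L', rfl, .lam h⟩
    | var => simp [LambdaTerm.rename] at e
    | app => simp [LambdaTerm.rename] at e
  | beta _ _ ihM ihN =>
    intro r L e
    cases L with
    | app L₁ L₂ =>
      cases L₁ with
      | lam L₁ =>
        simp only [LambdaTerm.rename, LambdaTerm.app.injEq, LambdaTerm.lam.injEq] at e
        obtain ⟨L₁', rfl, h₁⟩ := ihM e.1
        obtain ⟨L₂', rfl, h₂⟩ := ihN e.2
        exact ⟨_, (rename_subst_single r L₁' L₂').symm, .beta h₁ h₂⟩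
      | var => simp [LambdaTerm.rename] at e
      | app => simp [LambdaTerm.rename] at e
    | var => simp [LambdaTerm.rename] at e
    | lam => simp [LambdaTerm.rename] at e
  | @eta X M M' hX _ ih =>
    intro r L e
    rcases L with _ | _ | (_ | ⟨L₁, L₂⟩ | _) <;> simp [LambdaTerm.rename] at e
    obtain ⟨e₁, e₂⟩ := e
    rcases L₂ with (_ | _) | _ | _ <;> simp [LambdaTerm.rename, liftRen] at e₂
    obtain ⟨K, rfl, rfl⟩ := exists_of_rename_eq_rename L₁ M (liftRen r) Nat.succ r Nat.succ (by
      intro n m hnm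
      cases n with
      | zero => simp [liftRen] at hnm
      | succ n => exact ⟨n, rfl, (by simpa [liftRen] using hnm.symm)⟩) (e₁.symm.trans hX)
    obtain ⟨L', rfl, h⟩ := ih rfl
    exact ⟨L', rfl, .eta rfl h⟩

theorem Par.of_var {n : ℕ} {N : LambdaTerm} (h : Par (LambdaTerm.var n) N) :
    N = LambdaTerm.var n := by
  cases h; rfl

/-- A parallel reduction inside the body of an η-redex `λx. L x` either keeps the η-redex or
contracts `L x` for an abstraction `L`, which yields a parallel reduct of `L` itself. -/
theorem Par.of_eta_body {L N : LambdaTerm}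
    (h : Par (LambdaTerm.app (LambdaTerm.rename Nat.succ L) (LambdaTerm.var 0)) N) :
    ∃ L', Par L L' ∧ (N = LambdaTerm.app (LambdaTerm.rename Nat.succ L') (LambdaTerm.var 0) ∨
      L' = LambdaTerm.lam N) := by
  generalize hX : LambdaTerm.rename Nat.succ L = X at h
  cases h with
  | app h₁ h₂ =>
    obtain ⟨L', rfl, hL⟩ := h₁.of_rename hX.symm
    rw [h₂.of_var]
    exact ⟨L', hL, .inl rfl⟩
  | beta h₁ h₂ =>
    rcases L with _ | _ | K <;> simp [LambdaTerm.rename] at hX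
    obtain ⟨K', rfl, hK⟩ := h₁.of_rename hX.symm
    rw [h₂.of_var, subst_single_var_rename]
    exact ⟨_, .lam hK, .inr rfl⟩

/-- Every term `M` has a complete development `D`: each parallel reduct of `M` reduces to `D` in
one parallel step. -/
theorem Par.exists_development (M : LambdaTerm) : ∃ D, ∀ N, Par M N → Par N D := by
  induction hk : M.size using Nat.strong_induction_on generalizing M with
  | _ k ih =>
    subst hk
    cases M with
    | var n => exact ⟨LambdaTerm.var n, fun N h => by rw [h.of_var]; exact .var n⟩
    | lam M =>
      by_cases hη : ∃ L, M = LambdaTerm.app (LambdaTerm.rename Nat.succ L) (LambdaTerm.var 0)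
      · obtain ⟨L, rfl⟩ := hη
        obtain ⟨D, hD⟩ := ih L.size (by simp only [size, size_rename]; omega) L rfl
        refine ⟨D, fun N h => ?_⟩
        cases h with
        | lam h =>
          obtain ⟨L', hL, rfl | rfl⟩ := h.of_eta_body
          · exact .eta rfl (hD _ hL)
          · exact hD _ hL
        | eta hX h => exact hD _ (rename_succ_injective hX ▸ h)
      · obtain ⟨D, hD⟩ := ih M.size (by simp only [size]; omega) M rfl
        refine ⟨LambdaTerm.lam D, fun N h => ?_⟩
        cases h with
        | lam h => exact .lam (hD _ h)
        | eta hX h => exact absurd ⟨_, by rw [hX]⟩ hη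
    | app M₁ M₂ =>
      obtain ⟨D₂, hD₂⟩ := ih M₂.size (by simp only [size]; omega) M₂ rfl
      by_cases hβ : ∃ K, M₁ = LambdaTerm.lam K
      · obtain ⟨K, rfl⟩ := hβ
        obtain ⟨D, hD⟩ := ih K.size (by simp only [size]; omega) K rfl
        refine ⟨LambdaTerm.subst (single D₂) D, fun N h => ?_⟩
        cases h with
        | beta h₁ h₂ => exact (hD _ h₁).subst_single (hD₂ _ h₂)
        | app h₁ h₂ =>
          cases h₁ with
          | lam h₁ => exact .beta (hD _ h₁) (hD₂ _ h₂)
          | @eta X L L' hX h₁ =>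
            -- `(λx. L x) M₂` η-reduces to `L' M₂'`, an instance of the reduct `L' x` of the body.
            have h := (hD _ (.app (hX ▸ h₁.rename Nat.succ) (.var 0))).subst_single (hD₂ _ h₂)
            simpa only [LambdaTerm.subst, subst_single_rename_succ, single] using h
      · obtain ⟨D₁, hD₁⟩ := ih M₁.size (by simp only [size]; omega) M₁ rfl
        refine ⟨LambdaTerm.app D₁ D₂, fun N h => ?_⟩
        cases h with
        | app h₁ h₂ => exact .app (hD₁ _ h₁) (hD₂ _ h₂)
        | beta h₁ h₂ => exact absurd ⟨_, rfl⟩ hβ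

/-- The Church–Rosser property of βη-reduction. -/
theorem BetaEtaEq.join {M N : LambdaTerm} (h : BetaEtaEq M N) :
    Relation.Join (Relation.ReflTransGen Par) M N := by
  have hcr : ∀ a b c, Par a b → Par a c →
      ∃ d, Relation.ReflGen Par b d ∧ Relation.ReflTransGen Par c d := by
    intro a b c hb hc
    obtain ⟨D, hD⟩ := Par.exists_development a
    exact ⟨D, .single (hD _ hb), .single (hD _ hc)⟩
  have hequiv := Relation.equivalence_join_reflTransGen hcr
  induction h with
  | rel M N h => exact ⟨N, .single (.of_step h), .refl⟩
  | refl M => exact hequiv.refl M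
  | symm _ _ _ ih => exact hequiv.symm ih
  | trans _ _ _ _ _ ih₁ ih₂ => exact hequiv.trans ih₁ ih₂

/-- The terms without abstractions. -/
inductive IsApplicative : LambdaTerm → Prop
  | var (n : ℕ) : IsApplicative (var n)
  | app {M N : LambdaTerm} : IsApplicative M → IsApplicative N → IsApplicative (app M N)

theorem IsApplicative.eq_of_par {M : LambdaTerm} (hM : IsApplicative M) :
    ∀ {N : LambdaTerm}, Par M N → N = M := by
  induction hM with
  | var n => intro N h; exact h.of_var
  | app h₁ _ ih₁ ih₂ =>
    intro N h
    cases h with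
    | app h₁ h₂ => rw [ih₁ h₁, ih₂ h₂]
    | beta => cases h₁

theorem IsApplicative.eq_of_reflTransGen {M N : LambdaTerm} (hM : IsApplicative M)
    (h : Relation.ReflTransGen Par M N) : N = M := by
  induction h with
  | refl => rfl
  | tail _ h ih => subst ih; exact hM.eq_of_par h

/-- Terms without abstractions are normal, hence βη-equivalent only if they coincide. -/
theorem IsApplicative.eq_of_betaEtaEq {M N : LambdaTerm} (hM : IsApplicative M)
    (hN : IsApplicative N) (h : BetaEtaEq M N) : M = N := by
  obtain ⟨K, h₁, h₂⟩ := h.join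
  rw [← hM.eq_of_reflTransGen h₁, hN.eq_of_reflTransGen h₂]

/-! ### The algebra of λ-terms modulo βη-equivalence -/

/-- λ-terms modulo βη-equivalence. -/
def Class : Type := Quot BetaEtaStep

/-- The class of a λ-term. -/
def cls (M : LambdaTerm) : Class := Quot.mk _ M

theorem cls_eq_cls {M N : LambdaTerm} : cls M = cls N ↔ BetaEtaEq M N :=
  Quot.eq

namespace Class

/-- Application of classes. -/
def app : Class → Class → Class :=
  Quot.map₂ LambdaTerm.app (fun M _ _ h => .appRight M h) (fun _ _ N h => .appLeft N h)

infixl:70 " ⬝ " => app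

/-- The class of the combinator `B`. -/
def b : Class := cls BTerm.B.toLambda

/-- Composition of classes. -/
def comp (x y : Class) : Class := b ⬝ x ⬝ y

theorem cls_app (M N : LambdaTerm) : cls (LambdaTerm.app M N) = cls M ⬝ cls N := rfl

/-- Extensionality: it is enough to compare two terms on a fresh variable. -/
theorem ext_var {M N : LambdaTerm}
    (h : cls (rename Nat.succ M) ⬝ cls (var 0) = cls (rename Nat.succ N) ⬝ cls (var 0)) :
    cls M = cls N := by
  have hlam : ∀ {P Q : LambdaTerm}, cls P = cls Q → cls (lam P) = cls (lam Q) := by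
    intro P Q hPQ
    exact congrArg (Quot.map LambdaTerm.lam fun _ _ => BetaEtaStep.lam) hPQ
  have hη : ∀ P : LambdaTerm,
      cls (lam (LambdaTerm.app (rename Nat.succ P) (var 0))) = cls P :=
    fun P => Quot.sound (.eta P)
  rw [← hη M, ← hη N]
  exact hlam h

theorem b_app (x y z : Class) : b ⬝ x ⬝ y ⬝ z = x ⬝ (y ⬝ z) := by
  induction x using Quot.ind with | _ M
  induction y using Quot.ind with | _ N
  induction z using Quot.ind with | _ P
  have hβ : ∀ M N, cls (LambdaTerm.app (lam M) N) = cls (subst (single N) M) :=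
    fun M N => Quot.sound (.beta M N)
  change cls (lam _) ⬝ cls M ⬝ cls N ⬝ cls P = cls M ⬝ (cls N ⬝ cls P)
  rw [← cls_app, hβ]
  simp only [subst]
  rw [← cls_app, hβ]
  simp only [subst]
  rw [← cls_app, hβ]
  simp only [subst, liftSub, single, rename, cls_app, subst_single_rename_succ,
    subst_liftSub_succ]

theorem comp_app (x y z : Class) : comp x y ⬝ z = x ⬝ (y ⬝ z) := b_app x y z

theorem comp_assoc (x y z : Class) : comp (comp x y) z = comp x (comp y z) := by
  induction x using Quot.ind with | _ M
  induction y using Quot.ind with | _ N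
  induction z using Quot.ind with | _ P
  let c (M N : LambdaTerm) : LambdaTerm := .app (.app BTerm.B.toLambda M) N
  have hc : ∀ M N, cls (rename Nat.succ (c M N)) =
      comp (cls (rename Nat.succ M)) (cls (rename Nat.succ N)) := fun _ _ => rfl
  change cls (c (c M N) P) = cls (c M (c N P))
  apply ext_var
  simp only [hc, comp_app]

theorem b_comp (x y : Class) : b ⬝ comp x y = comp (b ⬝ x) (b ⬝ y) := by
  induction x using Quot.ind with | _ M
  induction y using Quot.ind with | _ N
  let B := BTerm.B.toLambda
  change cls (.app B (.app (.app B M) N)) = cls (.app (.app B (.app B M)) (.app B N))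
  apply ext_var
  change b ⬝ comp (cls (rename Nat.succ M)) (cls (rename Nat.succ N)) ⬝ cls (var 0) =
    comp (b ⬝ cls (rename Nat.succ M)) (b ⬝ cls (rename Nat.succ N)) ⬝ cls (var 0)
  rw [comp_app]
  exact comp_assoc _ _ _

theorem comp_b_b (x : Class) : comp b (b ⬝ x) = comp (b ⬝ (b ⬝ x)) b := by
  induction x using Quot.ind with | _ M
  let B := BTerm.B.toLambda
  change cls (.app (.app B B) (.app B M)) = cls (.app (.app B (.app B (.app B M))) B)
  apply ext_var
  change comp b (b ⬝ cls (rename Nat.succ M)) ⬝ cls (var 0) =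
    comp (b ⬝ (b ⬝ cls (rename Nat.succ M))) b ⬝ cls (var 0)
  rw [comp_app, comp_app]
  exact b_comp _ _

end Class

end LambdaTerm

namespace BTerm

open LambdaTerm LambdaTerm.Class

/-- The βη-class of the λ-term denoted by a `B`-term. -/
def eval (e : BTerm) : LambdaTerm.Class := cls e.toLambda

theorem equivalent_iff {e₁ e₂ : BTerm} : Equivalent e₁ e₂ ↔ eval e₁ = eval e₂ :=
  cls_eq_cls.symm

theorem eval_comp (e₁ e₂ : BTerm) : eval (comp e₁ e₂) = Class.comp (eval e₁) (eval e₂) := rfl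

theorem eval_monomial_succ (n : ℕ) : eval (monomial (n + 1)) = b ⬝ eval (monomial n) := rfl

/-! ### Existence of the normal form -/

theorem comp_monomial_of_lt (m : ℕ) : ∀ n, m < n →
    Class.comp (eval (monomial m)) (eval (monomial n)) =
      Class.comp (eval (monomial (n + 1))) (eval (monomial m)) := by
  induction m with
  | zero =>
    intro n hn
    obtain ⟨n, rfl⟩ := Nat.exists_eq_succ_of_ne_zero hn.ne'
    exact comp_b_b (eval (monomial n))
  | succ m ih =>
    intro n hn
    obtain ⟨n, rfl⟩ := Nat.exists_eq_succ_of_ne_zero (Nat.ne_zero_of_lt hn)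
    simp only [Nat.succ_eq_add_one, eval_monomial_succ (n + 1), eval_monomial_succ m,
      eval_monomial_succ n, ← b_comp]
    rw [← eval_monomial_succ n, ih n (by omega)]

theorem polynomial_concat (ns : List ℕ) (hns : ns ≠ []) (m : ℕ) :
    polynomial (ns ++ [m]) (by simp) = comp (polynomial ns hns) (monomial m) := by
  cases ns with
  | nil => exact absurd rfl hns
  | cons n ns => simp [polynomial]

/-- The class of a sorted polynomial. -/
def IsSortedPolynomial (x : LambdaTerm.Class) : Prop :=
  ∃ (ns : List ℕ) (hns : ns ≠ []), ns.SortedGE ∧ x = eval (polynomial ns hns)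

/-- Appending a monomial to a sorted polynomial: the monomial moves to the left past all smaller
degrees, and its own degree grows by one at each step. -/
theorem exists_sorted_concat (ns : List ℕ) (hns : ns ≠ []) (hs : ns.Pairwise (· ≥ ·)) (m : ℕ) :
    ∃ (l : List ℕ) (hl : l ≠ []), l.Pairwise (· ≥ ·) ∧ (∀ k ∈ l, k ∈ ns ∨ m ≤ k) ∧
      Class.comp (eval (polynomial ns hns)) (eval (monomial m)) = eval (polynomial l hl) := by
  induction ns using List.reverseRecOn generalizing m with
  | nil => exact absurd rfl hns
  | append_singleton ns n ih =>
    rcases le_or_gt m n with hmn | hmn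
    · refine ⟨ns ++ [n] ++ [m], by simp, ?_, ?_, ?_⟩
      · rw [List.pairwise_append]
        refine ⟨hs, List.pairwise_singleton _ _, ?_⟩
        rw [List.pairwise_append] at hs
        intro a ha c hc
        simp only [List.mem_append, List.mem_singleton] at ha hc
        subst hc
        rcases ha with ha | rfl
        · exact hmn.trans (hs.2.2 a ha n (by simp))
        · exact hmn
      · intro k hk
        simp only [List.mem_append, List.mem_singleton] at hk ⊢
        rcases hk with hk | rfl
        · exact .inl hk
        · exact .inr le_rfl
      · rw [polynomial_concat _ hns, eval_comp]
    · rcases eq_or_ne ns [] with rfl | hne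
      · refine ⟨[m + 1, n], by simp, by simp; omega, ?_, ?_⟩
        · intro k hk
          simp only [List.mem_cons, List.not_mem_nil, or_false] at hk
          rcases hk with rfl | rfl
          · exact .inr (by omega)
          · exact .inl (by simp)
        · exact comp_monomial_of_lt n m hmn
      · rw [List.pairwise_append] at hs
        obtain ⟨l, hl, hls, hmem, hl_eq⟩ := ih hne hs.1 (m + 1)
        refine ⟨l ++ [n], by simp, ?_, ?_, ?_⟩
        · rw [List.pairwise_append]
          refine ⟨hls, List.pairwise_singleton _ _, ?_⟩
          intro a ha c hc
          rw [List.mem_singleton] at hc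
          subst hc
          rcases hmem a ha with h | h
          · exact hs.2.2 a h c (by simp)
          · exact (show c ≤ a by omega)
        · intro k hk
          simp only [List.mem_append, List.mem_singleton] at hk ⊢
          rcases hk with hk | rfl
          · rcases hmem k hk with h | h
            · exact .inl (.inl h)
            · exact .inr (by omega)
          · exact .inl (.inr rfl)
        · rw [polynomial_concat _ hne, polynomial_concat _ hl, eval_comp, eval_comp, ← hl_eq,
            LambdaTerm.Class.comp_assoc, LambdaTerm.Class.comp_assoc, comp_monomial_of_lt n m hmn]

theorem IsSortedPolynomial.comp_monomial {x : LambdaTerm.Class} (hx : IsSortedPolynomial x)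
    (m : ℕ) : IsSortedPolynomial (Class.comp x (eval (monomial m))) := by
  obtain ⟨ns, hns, hs, rfl⟩ := hx
  obtain ⟨l, hl, hls, -, h⟩ := exists_sorted_concat ns hns hs.pairwise m
  exact ⟨l, hl, hls.sortedGE, h⟩

theorem isSortedPolynomial_monomial (n : ℕ) : IsSortedPolynomial (eval (monomial n)) :=
  ⟨[n], by simp, (List.pairwise_singleton _ _).sortedGE, rfl⟩

theorem IsSortedPolynomial.comp {x y : LambdaTerm.Class} (hx : IsSortedPolynomial x)
    (hy : IsSortedPolynomial y) : IsSortedPolynomial (Class.comp x y) := by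
  obtain ⟨ns, hns, -, rfl⟩ := hy
  induction ns using List.reverseRecOn with
  | nil => exact absurd rfl hns
  | append_singleton ns n ih =>
    rcases eq_or_ne ns [] with rfl | hne
    · exact hx.comp_monomial n
    · rw [polynomial_concat _ hne, eval_comp, ← LambdaTerm.Class.comp_assoc]
      exact (ih hne).comp_monomial n

theorem IsSortedPolynomial.b_app {x : LambdaTerm.Class} (hx : IsSortedPolynomial x) :
    IsSortedPolynomial (b ⬝ x) := by
  obtain ⟨ns, hns, -, rfl⟩ := hx
  induction ns using List.reverseRecOn with
  | nil => exact absurd rfl hns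
  | append_singleton ns n ih =>
    rcases eq_or_ne ns [] with rfl | hne
    · exact isSortedPolynomial_monomial (n + 1)
    · rw [polynomial_concat _ hne, eval_comp, b_comp]
      exact (ih hne).comp_monomial (n + 1)

/-- Sorted polynomials are closed under application: `B P` raises all degrees of `P`, while
`(Bⁿ⁺¹ B) P` is the composition of `Bⁿ B` with `P`. -/
theorem IsSortedPolynomial.app {x y : LambdaTerm.Class} (hx : IsSortedPolynomial x)
    (hy : IsSortedPolynomial y) : IsSortedPolynomial (x ⬝ y) := by
  have hmono : ∀ (n : ℕ) {y : LambdaTerm.Class}, IsSortedPolynomial y →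
      IsSortedPolynomial (eval (monomial n) ⬝ y) := by
    intro n y hy
    cases n with
    | zero => exact hy.b_app
    | succ n => exact (isSortedPolynomial_monomial n).comp hy
  obtain ⟨ns, hns, -, rfl⟩ := hx
  induction ns using List.reverseRecOn generalizing y with
  | nil => exact absurd rfl hns
  | append_singleton ns n ih =>
    rcases eq_or_ne ns [] with rfl | hne
    · exact hmono n hy
    · rw [polynomial_concat _ hne, eval_comp, comp_app]
      exact ih (hmono n hy) hne

theorem isSortedPolynomial_eval (e : BTerm) : IsSortedPolynomial (eval e) := by
  induction e with
  | B => exact isSortedPolynomial_monomial 0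
  | app e₁ e₂ ih₁ ih₂ => exact ih₁.app ih₂

/-! ### Action on argument sequences and uniqueness of the normal form -/

/-- The sequence `x` with the terms in positions `n` and `n + 1` replaced by the application of
the former to the latter. -/
def merge (n : ℕ) (x : ℕ → LambdaTerm) (i : ℕ) : LambdaTerm :=
  if i < n then x i else if i = n then .app (x n) (x (n + 1)) else x (i + 1)

theorem merge_of_lt {n i : ℕ} (h : i < n) (x : ℕ → LambdaTerm) : merge n x i = x i :=
  if_pos h

theorem merge_self (n : ℕ) (x : ℕ → LambdaTerm) : merge n x n = .app (x n) (x (n + 1)) := by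
  simp [merge]

theorem merge_of_gt {n i : ℕ} (h : n < i) (x : ℕ → LambdaTerm) : merge n x i = x (i + 1) := by
  simp [merge, h.not_gt, h.ne']

theorem merge_injective (n : ℕ) : Function.Injective (merge n) := by
  intro x y h
  have happ := congrFun h n
  simp only [merge_self, LambdaTerm.app.injEq] at happ
  funext i
  rcases lt_trichotomy i n with hi | rfl | hi
  · simpa only [merge_of_lt hi] using congrFun h i
  · exact happ.1
  · obtain ⟨j, rfl⟩ : ∃ j, i = j + 1 := ⟨i - 1, by omega⟩
    rcases (Nat.lt_succ_iff.mp hi).eq_or_lt with rfl | hj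
    · exact happ.2
    · simpa only [merge_of_gt hj] using congrFun h j

/-- The action of a list of degrees on sequences of terms: the sequence is merged at the degrees
in the order of the list. -/
def act (ns : List ℕ) (x : ℕ → LambdaTerm) : ℕ → LambdaTerm :=
  ns.foldl (fun y n => merge n y) x

theorem act_concat (ns : List ℕ) (n : ℕ) (x : ℕ → LambdaTerm) :
    act (ns ++ [n]) x = merge n (act ns x) := by
  simp [act]

/-- Merging at positions from `m` on does not affect the positions below `m`. -/
theorem act_of_lt {m i : ℕ} (hi : i < m) (ns : List ℕ) :
    (∀ n ∈ ns, m ≤ n) → ∀ x : ℕ → LambdaTerm, act ns x i = x i := by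
  induction ns using List.reverseRecOn with
  | nil => intro _ x; rfl
  | append_singleton ns n ih =>
    intro h x
    rw [act_concat, merge_of_lt (hi.trans_le (h n (by simp)))]
    exact ih (fun k hk => h k (by simp [hk])) x

/-- A non-increasing list of degrees is determined by its action on a sequence of variables: the
last degree is the first position that does not hold a variable, and merging is injective. -/
theorem eq_of_act_eq {v : ℕ → ℕ} (ns : List ℕ) : ∀ ms : List ℕ, ns.Pairwise (· ≥ ·) →
    ms.Pairwise (· ≥ ·) → act ns (fun i => .var (v i)) = act ms (fun i => .var (v i)) →
      ns = ms := by
  induction ns using List.reverseRecOn with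
  | nil =>
    intro ms _ _ h
    cases ms using List.reverseRecOn with
    | nil => rfl
    | append_singleton ms m =>
      have := congrFun h m
      rw [act_concat, merge_self] at this
      cases this
  | append_singleton ns n ih =>
    intro ms hns hms h
    cases ms using List.reverseRecOn with
    | nil =>
      have := congrFun h n
      rw [act_concat, merge_self] at this
      cases this
    | append_singleton ms m =>
      rw [List.pairwise_append] at hns hms
      rw [act_concat, act_concat] at h
      have hle {ls : List ℕ} {l : ℕ} (hl : ∀ a ∈ ls, ∀ c ∈ [l], a ≥ c) : ∀ a ∈ ls, l ≤ a :=
        fun a ha => hl a ha l (by simp)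
      obtain rfl : n = m := by
        rcases lt_trichotomy n m with hnm | hnm | hnm
        · have := congrFun h n
          rw [merge_self, merge_of_lt hnm, act_of_lt hnm _ (hle hms.2.2)] at this
          cases this
        · exact hnm
        · have := congrFun h m
          rw [merge_self, merge_of_lt hnm, act_of_lt hnm _ (hle hns.2.2)] at this
          cases this
      rw [ih ms hns.1 hms.1 (merge_injective n h)]

/-- The application of `M` to the first `N` terms of the sequence `x`. -/
def apps (M : LambdaTerm) (x : ℕ → LambdaTerm) : ℕ → LambdaTerm
  | 0 => M
  | N + 1 => .app (apps M x N) (x N)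

/-- The application of a class to the classes of the first `N` terms of the sequence `x`. -/
def clsApps (c : LambdaTerm.Class) (x : ℕ → LambdaTerm) : ℕ → LambdaTerm.Class
  | 0 => c
  | N + 1 => clsApps c x N ⬝ cls (x N)

theorem cls_apps (M : LambdaTerm) (x : ℕ → LambdaTerm) (N : ℕ) :
    cls (apps M x N) = clsApps (cls M) x N := by
  induction N with
  | zero => rfl
  | succ N ih => rw [apps, cls_app, ih, clsApps]

theorem clsApps_succ' (c : LambdaTerm.Class) (x : ℕ → LambdaTerm) (N : ℕ) :
    clsApps c x (N + 1) = clsApps (c ⬝ cls (x 0)) (fun i => x (i + 1)) N := by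
  induction N with
  | zero => rfl
  | succ N ih => rw [clsApps, ih, clsApps]

/-- `(Bⁿ B) c x₀ … x_N = c x₀ … xₙ₋₁ (xₙ xₙ₊₁) xₙ₊₂ … x_N`. -/
theorem clsApps_monomial (n : ℕ) : ∀ (c : LambdaTerm.Class) (x : ℕ → LambdaTerm) (N : ℕ), n < N →
    clsApps (eval (monomial n) ⬝ c) x (N + 1) = clsApps c (merge n x) N := by
  induction n with
  | zero =>
    intro c x N hN
    obtain ⟨N, rfl⟩ := Nat.exists_eq_succ_of_ne_zero hN.ne'
    rw [clsApps_succ', clsApps_succ', clsApps_succ']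
    congr 1
    exact Class.b_app _ _ _
  | succ n ih =>
    intro c x N hN
    obtain ⟨N, rfl⟩ : ∃ k, N = k + 1 := ⟨N - 1, by omega⟩
    rw [clsApps_succ', eval_monomial_succ, Class.b_app, ih _ _ _ (by omega), clsApps_succ']
    congr 1
    funext i
    simp only [merge, Nat.add_lt_add_iff_right, Nat.add_right_cancel_iff]

theorem clsApps_polynomial (ns : List ℕ) (hns : ns ≠ []) (x : ℕ → LambdaTerm) :
    ∀ (c : LambdaTerm.Class) (N : ℕ), (∀ n ∈ ns, n < N) →
      clsApps (eval (polynomial ns hns) ⬝ c) x (N + ns.length) = clsApps c (act ns x) N := by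
  induction ns using List.reverseRecOn with
  | nil => exact absurd rfl hns
  | append_singleton ns n ih =>
    intro c N hN
    have hn : n < N := hN n (by simp)
    rcases eq_or_ne ns [] with rfl | hne
    · exact clsApps_monomial n c x N hn
    · rw [polynomial_concat _ hne, eval_comp, comp_app, List.length_append, List.length_singleton,
        add_comm ns.length, ← add_assoc, ih hne, clsApps_monomial n _ _ _ hn, act_concat]
      intro k hk
      exact (hN k (by simp [hk])).trans (Nat.lt_succ_self N)

theorem apps_var_injective {k : ℕ} {x y : ℕ → LambdaTerm} (N : ℕ) : ∀ N' : ℕ,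
    apps (.var k) x N = apps (.var k) y N' → N = N' ∧ ∀ i < N, x i = y i := by
  induction N with
  | zero =>
    intro N' h
    cases N' with
    | zero => exact ⟨rfl, fun i hi => absurd hi (Nat.not_lt_zero i)⟩
    | succ N' => cases h
  | succ N ih =>
    intro N' h
    cases N' with
    | zero => cases h
    | succ N' =>
      simp only [apps, LambdaTerm.app.injEq] at h
      obtain ⟨rfl, hxy⟩ := ih N' h.1
      refine ⟨rfl, fun i hi => ?_⟩
      rcases (Nat.lt_succ_iff.mp hi).eq_or_lt with rfl | hi
      · exact h.2
      · exact hxy i hi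

theorem isApplicative_apps {M : LambdaTerm} (hM : M.IsApplicative) {x : ℕ → LambdaTerm}
    (hx : ∀ i, (x i).IsApplicative) (N : ℕ) : (apps M x N).IsApplicative := by
  induction N with
  | zero => exact hM
  | succ N ih => exact .app ih (hx N)

theorem isApplicative_act (ns : List ℕ) {x : ℕ → LambdaTerm} (hx : ∀ i, (x i).IsApplicative) :
    ∀ i, (act ns x i).IsApplicative := by
  induction ns using List.reverseRecOn with
  | nil => exact hx
  | append_singleton ns n ih =>
    intro i
    rw [act_concat, merge]
    split_ifs
    · exact ih i
    · exact .app (ih n) (ih (n + 1))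
    · exact ih (i + 1)

theorem eq_of_eval_polynomial_eq {ns ms : List ℕ} (hns : ns ≠ []) (hms : ms ≠ [])
    (hns' : ns.SortedGE) (hms' : ms.SortedGE)
    (h : eval (polynomial ns hns) = eval (polynomial ms hms)) : ns = ms := by
  refine eq_of_act_eq (v := fun i => i) ns ms hns'.pairwise hms'.pairwise (funext fun i => ?_)
  -- Both polynomials are applied to the same variables, in a number that exceeds all degrees
  -- and leaves more than `i` arguments after the merges.
  let T := ns.sum + ms.sum + i + 1
  have hT {n : ℕ} (hn : n ∈ ns ∨ n ∈ ms) : n < T := by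
    rcases hn with hn | hn <;> have := List.le_sum_of_mem hn <;> omega
  let x : ℕ → LambdaTerm := fun i => .var i
  have hx : ∀ i, (x i).IsApplicative := fun i => .var i
  have h₁ := clsApps_polynomial ns hns x (cls (.var 0)) (T + ms.length) fun n hn => by
    have := hT (.inl hn); omega
  have h₂ := clsApps_polynomial ms hms x (cls (.var 0)) (T + ns.length) fun n hn => by
    have := hT (.inr hn); omega
  rw [add_right_comm, h, h₂, ← cls_apps, ← cls_apps, cls_eq_cls] at h₁
  have heq := (isApplicative_apps (.var 0) (isApplicative_act ms hx) _).eq_of_betaEtaEq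
    (isApplicative_apps (.var 0) (isApplicative_act ns hx) _) h₁
  exact ((apps_var_injective _ _ heq).2 i (by omega)).symm

end BTerm

end BCL

theorem mainTheorem2 (e : BCL.BTerm) :
    ∃! ns : List ℕ, ∃ hns : ns ≠ [],
      ns.SortedGE ∧ BCL.BTerm.Equivalent e (BCL.BTerm.polynomial ns hns) := by
  obtain ⟨ns, hns, hs, h⟩ := BCL.BTerm.isSortedPolynomial_eval e
  refine ⟨ns, ⟨hns, hs, BCL.BTerm.equivalent_iff.mpr h⟩, ?_⟩
  rintro ms ⟨hms, hs', h'⟩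
  exact BCL.BTerm.eq_of_eval_polynomial_eq hms hns hs' hs
    ((BCL.BTerm.equivalent_iff.mp h').symm.trans h)
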